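/- Conventions. Rings are associative with $1$. For a ring $T$ and a right $T$-module $N$, $\mathrm{Add}(N)$ is the full subcategory of right $T$-modules isomorphic to direct summands of direct sums $N^{(\Lambda)}$, $\Lambda$ an arbitrary set. For right $T$-modules $X, A, B$, let $\mathcal{I}_X(A,B)$ be the group of homomorphisms $A\to B$ that factor through $X^n$ for some $n\in\mathbb{N}$, and $\mathcal{J}_X(A,B)$ the group of those that factor through $X^{(\Lambda)}$ for some set $\Lambda$. For a full subcategory $\mathcal C$ of right $T$-modules, $\mathcal C/\mathcal{J}_X$ is the category with the same objects as $\mathcal C$ and with morphism sets $\mathrm{Hom}_T(A,B)/\mathcal{J}_X(A,B)$. The trace of a right $T$-module $P$ is the two-sided ideal $\mathrm{Tr}_T(P)=\sum_{f\in\mathrm{Hom}_T(P,T)}f(P)$ of $T$. Theorem. Let $M$ be a finitely generated right module over a ring $R$, and let $S=\mathrm{End}_R(M)$. Let $X$ be an object of $\mathrm{Add}(M)$, and let $I=\mathrm{Tr}_S(P)$, where $P=\mathrm{Hom}_R(M,X)$ is regarded as a right $S$-module by composition. Then: (i) $I=\mathcal{I}_X(M,M)=\mathcal{J}_X(M,M)$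 and, for any $B\in\mathrm{Add}(M)$, $\mathcal{I}_X(M,B)=\mathcal{J}_X(M,B)=\mathrm{Hom}_R(M,B)\,I$, the group of finite sums of homomorphisms $f\circ s$ with $f\in\mathrm{Hom}_R(M,B)$ and $s\in I$. (ii) The functor $F=\mathrm{Hom}_R(M,-)\otimes_S S/I$ induces an equivalence between the categories $\mathrm{Add}(M)/\mathcal{J}_X$ and $\mathrm{Add}(S/I)$, where $S/I$ is regarded as a right module over itself. (iii) Let $\mathrm{Add}_{\aleph_0}(M)$ be the full subcategory of $\mathrm{Add}(M)$ whose objects are the countably generated modules in $\mathrm{Add}(M)$. If $X$ is an object of $\mathrm{Add}_{\aleph_0}(M)$, then $F$ restricts to an equivalence between $\mathrm{Add}_{\aleph_0}(M)/\mathcal{J}_X$ and the category of countably generated projective right modules over $S/I$. -/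

import Mathlib

universe u v w

namespace TraceQuotient

open CategoryTheory MulOpposite
open scoped TensorProduct

/-! Right modules over a ring `R` are modules over `Rᵐᵒᵖ`. -/

/-! ### `Add(M)` and countably generated modules -/

/-- `Add(M)`: the modules `A` that are isomorphic to a direct summand of a direct sum `M^(Λ)`. -/
def addClosure {T : Type u} [Ring T] (M : ModuleCat.{v} T) : ObjectProperty (ModuleCat.{v} T) :=
  fun A => ∃ (Λ : Type v) (C : ModuleCat.{v} T), Nonempty ((A × C) ≃ₗ[T] (Λ →₀ M))

/-- A module is countably generated if it is spanned by a countable set. -/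
def IsCountablyGenerated {T : Type u} [Ring T] (A : ModuleCat.{v} T) : Prop :=
  ∃ s : Set A, s.Countable ∧ Submodule.span T s = ⊤

/-- `Add_ℵ₀(M)`: the countably generated modules in `Add(M)`. -/
def countableAddClosure {T : Type u} [Ring T] (M : ModuleCat.{v} T) :
    ObjectProperty (ModuleCat.{v} T) :=
  fun A => addClosure M A ∧ IsCountablyGenerated A

/-- The countably generated projective modules. -/
def countableProjective (T : Type u) [Ring T] : ObjectProperty (ModuleCat.{v} T) :=
  fun A => Module.Projective T A ∧ IsCountablyGenerated A

/-! ### The ideals `𝓘_X` and `𝓙_X` -/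

section Ideals

variable {T : Type u} [Ring T]

/-- The morphism `f` factors through the direct sum `X^(Λ)`. -/
def FactorsThroughCopower (X : ModuleCat.{v} T) (Λ : Type w) {A B : ModuleCat.{v} T}
    (f : A ⟶ B) : Prop :=
  ∃ (g : A →ₗ[T] (Λ →₀ X)) (h : (Λ →₀ X) →ₗ[T] B), f.hom = h ∘ₗ g

variable {X A B C : ModuleCat.{v} T}

theorem FactorsThroughCopower.zero (Λ : Type w) :
    FactorsThroughCopower X Λ (0 : A ⟶ B) :=
  ⟨0, 0, by simp⟩

theorem FactorsThroughCopower.neg {Λ : Type w} {f : A ⟶ B}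
    (hf : FactorsThroughCopower X Λ f) : FactorsThroughCopower X Λ (-f) := by
  obtain ⟨g, h, e⟩ := hf
  exact ⟨g, -h, by rw [ModuleCat.hom_neg, e, LinearMap.neg_comp]⟩

theorem FactorsThroughCopower.add {Λ Λ' Λ'' : Type*} (e : Λ ⊕ Λ' ≃ Λ'') {f f' : A ⟶ B}
    (hf : FactorsThroughCopower X Λ f) (hf' : FactorsThroughCopower X Λ' f') :
    FactorsThroughCopower X Λ'' (f + f') := by
  obtain ⟨g, h, eq⟩ := hf
  obtain ⟨g', h', eq'⟩ := hf'
  let E : (Λ'' →₀ X) ≃ₗ[T] (Λ →₀ X) × (Λ' →₀ X) :=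
    (Finsupp.domLCongr e.symm).trans (Finsupp.sumFinsuppLEquivProdFinsupp T)
  refine ⟨E.symm.toLinearMap ∘ₗ g.prod g', h.coprod h' ∘ₗ E.toLinearMap, ?_⟩
  ext a
  simp [eq, eq']

theorem FactorsThroughCopower.comp_left {Λ : Type w} {f : A ⟶ B} (g : B ⟶ C)
    (hf : FactorsThroughCopower X Λ f) : FactorsThroughCopower X Λ (f ≫ g) := by
  obtain ⟨p, q, e⟩ := hf
  exact ⟨p, g.hom ∘ₗ q, by rw [ModuleCat.hom_comp, e, LinearMap.comp_assoc]⟩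

theorem FactorsThroughCopower.comp_right {Λ : Type w} (f : A ⟶ B) {g : B ⟶ C}
    (hg : FactorsThroughCopower X Λ g) : FactorsThroughCopower X Λ (f ≫ g) := by
  obtain ⟨p, q, e⟩ := hg
  exact ⟨p ∘ₗ f.hom, q, by rw [ModuleCat.hom_comp, e, LinearMap.comp_assoc]⟩

variable (X A B)

/-- `𝓘_X(A, B)`: the morphisms `A ⟶ B` that factor through `X^n` for some natural number `n`. -/
def finiteIdeal : AddSubgroup (A ⟶ B) where
  carrier := {f | ∃ n : ℕ, FactorsThroughCopower X (Fin n) f}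
  zero_mem' := ⟨0, .zero _⟩
  add_mem' := by
    rintro f g ⟨n, hf⟩ ⟨m, hg⟩
    exact ⟨n + m, hf.add finSumFinEquiv hg⟩
  neg_mem' := by
    rintro f ⟨n, hf⟩
    exact ⟨n, hf.neg⟩

/-- `𝓙_X(A, B)`: the morphisms `A ⟶ B` that factor through `X^(Λ)` for some set `Λ`. -/
def infiniteIdeal : AddSubgroup (A ⟶ B) where
  carrier := {f | ∃ Λ : Type v, FactorsThroughCopower X Λ f}
  zero_mem' := ⟨PEmpty, .zero _⟩
  add_mem' := by
    rintro f g ⟨Λ, hf⟩ ⟨Λ', hg⟩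
    exact ⟨Λ ⊕ Λ', hf.add (Equiv.refl _) hg⟩
  neg_mem' := by
    rintro f ⟨Λ, hf⟩
    exact ⟨Λ, hf.neg⟩

/-- Congruence modulo `𝓙_X` on a full subcategory of modules. -/
def idealRel (P : ObjectProperty (ModuleCat.{v} T)) (X : ModuleCat.{v} T) :
    HomRel P.FullSubcategory :=
  fun A B f g => f.hom - g.hom ∈ infiniteIdeal X A.obj B.obj

instance idealRel_congruence (P : ObjectProperty (ModuleCat.{v} T)) (X : ModuleCat.{v} T) :
    Congruence (idealRel P X) where
  comp_left f g g' h := by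
    obtain ⟨Λ, h⟩ := h
    refine ⟨Λ, ?_⟩
    simpa [Preadditive.comp_sub] using h.comp_right f.hom
  comp_right g h := by
    obtain ⟨Λ, h⟩ := h
    refine ⟨Λ, ?_⟩
    simpa [Preadditive.sub_comp] using h.comp_left g.hom
  equivalence :=
    { refl := fun f => by
        change f.hom - f.hom ∈ infiniteIdeal X _ _
        rw [sub_self]
        exact AddSubgroup.zero_mem _
      symm := fun {f g} h => by
        change g.hom - f.hom ∈ infiniteIdeal X _ _
        rw [← neg_sub]
        exact AddSubgroup.neg_mem _ h
      trans := fun {f g k} h h' => by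
        change f.hom - k.hom ∈ infiniteIdeal X _ _
        rw [← sub_add_sub_cancel f.hom g.hom k.hom]
        exact AddSubgroup.add_mem _ h h' }

/-- The quotient category of a full subcategory by `𝓙_X`: it has the same objects, and the
morphisms from `A` to `B` are the elements of `Hom(A, B) / 𝓙_X(A, B)`. -/
abbrev IdealQuotient (P : ObjectProperty (ModuleCat.{v} T)) (X : ModuleCat.{v} T) :=
  CategoryTheory.Quotient (idealRel P X)

end Ideals

/-! ### The trace of a right module -/

section Trace

variable (S : Type u) [Ring S] (P : Type v) [AddCommGroup P] [Module Sᵐᵒᵖ P]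

/-- The trace of a right `S`-module `P` as a right ideal: the sum of the images of all
homomorphisms of right modules `P → S`. -/
def rightTrace : Submodule Sᵐᵒᵖ S := ⨆ f : P →ₗ[Sᵐᵒᵖ] S, LinearMap.range f

theorem mul_mem_rightTrace (s : S) {x : S} (hx : x ∈ rightTrace S P) :
    s * x ∈ rightTrace S P := by
  let l : S →ₗ[Sᵐᵒᵖ] S :=
    { toFun := fun y => s * y
      map_add' := mul_add s
      map_smul' := fun r y => by simp [mul_assoc] }
  have h : rightTrace S P ≤ (rightTrace S P).comap l := by
    refine iSup_le fun f => ?_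
    rintro _ ⟨p, rfl⟩
    exact le_iSup (fun g : P →ₗ[Sᵐᵒᵖ] S => LinearMap.range g) (l ∘ₗ f) ⟨p, rfl⟩
  exact h hx

/-- The trace of a right `S`-module `P`, as a (two-sided) ideal of `S`. -/
def traceIdeal : Ideal S where
  carrier := rightTrace S P
  zero_mem' := zero_mem _
  add_mem' := add_mem
  smul_mem' s _ hx := mul_mem_rightTrace S P s hx

instance traceIdeal_isTwoSided : (traceIdeal S P).IsTwoSided where
  mul_mem_of_left b ha := (rightTrace S P).smul_mem (op b) ha

end Trace

/-! ### The tensor product `P ⊗_S N` of a right module and a bimodule -/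

section Tensor

variable (S : Type*) (U : Type*) [Ring S] [Ring U]
  (N : Type*) [AddCommGroup N] [Module S N] [Module Uᵐᵒᵖ N] [SMulCommClass S Uᵐᵒᵖ N]
  (P : Type*) [AddCommGroup P] [Module Sᵐᵒᵖ P]

/-- The relations `(p s) ⊗ n = p ⊗ (s n)`. The right `U`-action comes from `N`, which therefore
is written as the first factor of the tensor product over `ℤ`. -/
def balancedRelations : Submodule Uᵐᵒᵖ (N ⊗[ℤ] P) :=
  Submodule.span Uᵐᵒᵖ {t | ∃ (n : N) (s : S) (p : P), t = n ⊗ₜ[ℤ] (op s • p) - (s • n) ⊗ₜ[ℤ] p}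

/-- The right `U`-module `P ⊗_S N`, for a right `S`-module `P` and an `S`-`U`-bimodule `N`;
`p ⊗ n` is the class of `n ⊗ₜ p`. -/
abbrev BalancedTensor : Type _ := (N ⊗[ℤ] P) ⧸ balancedRelations S U N P

variable {P} {P' : Type*} [AddCommGroup P'] [Module Sᵐᵒᵖ P']

/-- `n ⊗ₜ p ↦ n ⊗ₜ f p`. -/
def preTensorMap (f : P →ₗ[Sᵐᵒᵖ] P') : N ⊗[ℤ] P →ₗ[Uᵐᵒᵖ] N ⊗[ℤ] P' :=
  TensorProduct.AlgebraTensorModule.map LinearMap.id f.toAddMonoidHom.toIntLinearMap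

@[simp]
theorem preTensorMap_tmul (f : P →ₗ[Sᵐᵒᵖ] P') (n : N) (p : P) :
    preTensorMap S U N f (n ⊗ₜ p) = n ⊗ₜ f p := rfl

/-- The homomorphism `f ⊗_S N : P ⊗_S N → P' ⊗_S N`. -/
def balancedTensorMap (f : P →ₗ[Sᵐᵒᵖ] P') :
    BalancedTensor S U N P →ₗ[Uᵐᵒᵖ] BalancedTensor S U N P' :=
  Submodule.mapQ _ _ (preTensorMap S U N f) <| by
    refine Submodule.span_le.2 ?_
    rintro _ ⟨n, s, p, rfl⟩
    refine Submodule.subset_span ⟨n, s, f p, ?_⟩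
    simp

@[simp]
theorem balancedTensorMap_mk (f : P →ₗ[Sᵐᵒᵖ] P') (x : N ⊗[ℤ] P) :
    balancedTensorMap S U N f (Submodule.Quotient.mk x) =
      Submodule.Quotient.mk (preTensorMap S U N f x) := rfl

end Tensor

/-- The functor `- ⊗_S N` from right `S`-modules to right `U`-modules. -/
def tensorFunctor (S U N : Type v) [Ring S] [Ring U] [AddCommGroup N] [Module S N]
    [Module Uᵐᵒᵖ N] [SMulCommClass S Uᵐᵒᵖ N] : ModuleCat.{v} Sᵐᵒᵖ ⥤ ModuleCat.{v} Uᵐᵒᵖ where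
  obj P := ModuleCat.of Uᵐᵒᵖ (BalancedTensor S U N P)
  map f := ModuleCat.ofHom (balancedTensorMap S U N f.hom)
  map_id P := by
    refine ModuleCat.hom_ext (LinearMap.ext fun x => ?_)
    obtain ⟨x, rfl⟩ := Submodule.Quotient.mk_surjective _ x
    induction x using TensorProduct.induction_on with
    | zero => simp
    | tmul n p => rfl
    | add x y hx hy => rw [Submodule.Quotient.mk_add, map_add, map_add, hx, hy]
  map_comp f g := by
    refine ModuleCat.hom_ext (LinearMap.ext fun x => ?_)
    obtain ⟨x, rfl⟩ := Submodule.Quotient.mk_surjective _ x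
    induction x using TensorProduct.induction_on with
    | zero => simp
    | tmul n p => rfl
    | add x y hx hy => rw [Submodule.Quotient.mk_add, map_add, map_add, hx, hy]

section Main

variable {R : Type u} [Ring R]

instance quotient_smulCommClass {S : Type v} [Ring S] (I : Ideal S) [I.IsTwoSided] :
    SMulCommClass S (S ⧸ I)ᵐᵒᵖ (S ⧸ I) where
  smul_comm s t x := by
    obtain ⟨x, rfl⟩ := Ideal.Quotient.mk_surjective x
    obtain ⟨t, rfl⟩ := op_surjective t
    obtain ⟨t, rfl⟩ := Ideal.Quotient.mk_surjective t
    change Ideal.Quotient.mk I (s * (x * t)) = Ideal.Quotient.mk I ((s * x) * t)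
    rw [mul_assoc]

/-- The trace ideal, in `S = End_R(M)`, of the right `S`-module `Hom_R(M, X)`.
The multiplication of `End M` is `s * t = s ∘ t`, and `s` acts on `Hom_R(M, X)` from the right
by `f ↦ f ∘ s`. -/
abbrev homTrace (M X : ModuleCat.{v} Rᵐᵒᵖ) : Ideal (End M) :=
  traceIdeal (End M) ((preadditiveCoyonedaObj M).obj X)

/-- `Hom_R(M, B) I`: the subgroup of finite sums of morphisms `f ∘ s` with `f : M ⟶ B` and
`s ∈ I`. -/
def homMulIdeal (M B : ModuleCat.{v} Rᵐᵒᵖ) (I : Ideal (End M)) : AddSubgroup (M ⟶ B) :=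
  AddSubgroup.closure {h | ∃ (f : M ⟶ B) (s : M ⟶ M), s ∈ I ∧ h = s ≫ f}

/-- The functor `Hom_R(M, -) ⊗_S S/I` from right `R`-modules to right `S/I`-modules, where
`S = End_R(M)`. -/
def homTensor (M : ModuleCat.{v} Rᵐᵒᵖ) (I : Ideal (End M)) [I.IsTwoSided] :
    ModuleCat.{v} Rᵐᵒᵖ ⥤ ModuleCat.{v} (End M ⧸ I)ᵐᵒᵖ :=
  preadditiveCoyonedaObj M ⋙ tensorFunctor (End M) (End M ⧸ I) (End M ⧸ I)

/-- The functor `F` on right `R`-modules induces an equivalence from the quotient of the full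
subcategory `P` by `𝓙_X` to the full subcategory `Q`: it maps `P` into `Q`, it identifies morphisms
of `P` that are congruent modulo `𝓙_X`, and the resulting functor is an equivalence. -/
def InducesEquivalence {T : Type u} [Ring T] {D : Type*} [Category D] (F : ModuleCat.{v} T ⥤ D)
    (P : ObjectProperty (ModuleCat.{v} T)) (X : ModuleCat.{v} T) (Q : ObjectProperty D) : Prop :=
  ∃ (hobj : ∀ A : P.FullSubcategory, Q ((P.ι ⋙ F).obj A))
    (hmap : ∀ (A B : P.FullSubcategory) (f g : A ⟶ B), idealRel P X f g →
      (Q.lift (P.ι ⋙ F) hobj).map f = (Q.lift (P.ι ⋙ F) hobj).map g),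
    (CategoryTheory.Quotient.lift (idealRel P X) (Q.lift (P.ι ⋙ F) hobj) hmap :
      IdealQuotient P X ⥤ Q.FullSubcategory).IsEquivalence

end Main

end TraceQuotient

open CategoryTheory TraceQuotient

/-! If `M` is self-small, `Hom_R(M, -) ⊗_S S/I` maps `M^(Λ)` to `(S/I)^(Λ)`, is full on `Add(M)`,
and kills exactly the homomorphisms in `𝓙_X`: on `M` itself these form `I`, because every element of
`Hom_R(M, X)` has a finite expansion in a dual basis, and `M^(Λ)` is treated one summand at a time.

Every object of `Add(S/I)` is reached. It is the image of an idempotent of `(S/I)^(Λ)`, which lifts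
to some `ε : L ⟶ L` with `L = M^(Λ)`, where `ε - ε²` factors through a direct sum `Y` of copies of
`X`; idempotents need not lift. Put `e = ε^(ℕ)` on `L^(ℕ)` and let `u`, `d` be the shifts up and
down, so that `d u = 1` and `u d = 1 - π` with `π` the projection onto the first summand. Then
`s = 1 - e + e u` and `p = 1 - e + e d` satisfy `p s ≡ 1` and `s p ≡ 1 - e² π` modulo `e - e²`. The
error term in `p s` factors through `Y^(ℕ)`, so `s` becomes a split monomorphism
`L^(ℕ) ⟶ L^(ℕ) ⊞ Y^(ℕ)` after adding a second component. Its complement lies in `Add(M)`, and modulo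
`𝓙_X` it is the image of `ε`, since `Y^(ℕ)` vanishes there and `1 - s p` becomes `e π`. -/

namespace TraceQuotient

open Limits MulOpposite
open scoped TensorProduct

/-! ### Direct sums and their retracts -/

noncomputable section Copowers

variable {T : Type u} [Ring T] {A B : ModuleCat.{v} T} {Λ : Type v}

/-- The direct sum `A^(Λ)`, as an object of the category of modules. -/
abbrev copower (A : ModuleCat.{v} T) (Λ : Type v) : ModuleCat.{v} T :=
  ModuleCat.of T (Λ →₀ A)

namespace copower

/-- The inclusion of a summand of `A^(Λ)`. -/
def ι (l : Λ) : A ⟶ copower A Λ := ModuleCat.ofHom (Finsupp.lsingle l)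

/-- The projection onto a summand of `A^(Λ)`. -/
def π (l : Λ) : copower A Λ ⟶ A := ModuleCat.ofHom (Finsupp.lapply l)

/-- The homomorphism out of `A^(Λ)` with given components. -/
def desc (f : Λ → (A ⟶ B)) : copower A Λ ⟶ B := ModuleCat.ofHom (Finsupp.lsum ℕ fun l => (f l).hom)

@[simp]
theorem ι_desc (f : Λ → (A ⟶ B)) (l : Λ) : ι l ≫ desc f = f l :=
  ModuleCat.hom_ext (Finsupp.lsum_comp_lsingle ℕ _ l)

@[simp]
theorem ι_π (l : Λ) : ι l ≫ π l = 𝟙 A :=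
  ModuleCat.hom_ext (LinearMap.ext fun _ => Finsupp.single_eq_same)

theorem ι_π_of_ne {k l : Λ} (h : k ≠ l) : ι k ≫ π l = (0 : A ⟶ A) :=
  ModuleCat.hom_ext (LinearMap.ext fun _ => Finsupp.single_eq_of_ne' h)

theorem hom_ext {f g : copower A Λ ⟶ B} (h : ∀ l, ι l ≫ f = ι l ≫ g) : f = g :=
  ModuleCat.hom_ext (Finsupp.lhom_ext' fun l => congrArg ModuleCat.Hom.hom (h l))

end copower

/-- A retraction of `B` onto `A` induces one of `B^(Λ)` onto `A^(Λ)`. -/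
def retractCopower (ρ : Retract A B) (Λ : Type v) : Retract (copower A Λ) (copower B Λ) where
  i := ModuleCat.ofHom (Finsupp.mapRange.linearMap ρ.i.hom)
  r := ModuleCat.ofHom (Finsupp.mapRange.linearMap ρ.r.hom)
  retract := by
    refine ModuleCat.hom_ext (LinearMap.ext fun x => Finsupp.ext fun l => ?_)
    exact ConcreteCategory.congr_hom ρ.retract (x l)

/-- The isomorphism `(A^(Λ))^(K) ≅ A^(K × Λ)`. -/
def copowerCopowerIso (A : ModuleCat.{v} T) (Λ K : Type v) :
    copower (copower A Λ) K ≅ copower A (K × Λ) :=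
  (Finsupp.curryLinearEquiv T).symm.toModuleIso

/-- The isomorphism `A^(Λ) ⊞ A^(K) ≅ A^(Λ ⊕ K)`. -/
def biprodCopowerIso (A : ModuleCat.{v} T) (Λ K : Type v) :
    copower A Λ ⊞ copower A K ≅ copower A (Λ ⊕ K) :=
  ModuleCat.biprodIsoProd _ _ ≪≫ (Finsupp.sumFinsuppLEquivProdFinsupp T).symm.toModuleIso

theorem addClosure_iff {M A : ModuleCat.{v} T} :
    addClosure M A ↔ ∃ Λ : Type v, Nonempty (Retract A (copower M Λ)) := by
  constructor
  · rintro ⟨Λ, C, ⟨e⟩⟩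
    refine ⟨Λ, ⟨⟨ModuleCat.ofHom (e ∘ₗ LinearMap.inl T A C),
      ModuleCat.ofHom (LinearMap.fst T A C ∘ₗ e.symm), ?_⟩⟩⟩
    ext a
    simp
  · rintro ⟨Λ, ⟨ρ⟩⟩
    have split : ρ.r.hom ∘ₗ ρ.i.hom = LinearMap.id := congrArg ModuleCat.Hom.hom ρ.retract
    exact ⟨Λ, ModuleCat.of T ((Λ →₀ M) ⧸ LinearMap.range ρ.i.hom),
      ⟨lequivProdOfLeftSplitExact (Submodule.mkQ_surjective _) (Submodule.ker_mkQ _).symm split⟩⟩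

theorem nonempty_retract_copower_of_range_le_supported {M A : ModuleCat.{v} T} (s : Set Λ)
    (ρ : Retract A (copower M Λ)) (hρ : LinearMap.range ρ.i.hom ≤ Finsupp.supported M T s) :
    Nonempty (Retract A (copower M s)) := by
  classical
  let e := Finsupp.supportedEquivFinsupp (M := M) (R := T) s
  refine ⟨⟨ModuleCat.ofHom (e.toLinearMap ∘ₗ ρ.i.hom.codRestrict _ fun a => hρ ⟨a, rfl⟩),
    ModuleCat.ofHom (ρ.r.hom ∘ₗ Submodule.subtype _ ∘ₗ e.symm.toLinearMap), ?_⟩⟩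
  ext a
  simpa [-Retract.retract] using ConcreteCategory.congr_hom ρ.retract a

end Copowers

section CountablyGenerated

variable {T : Type u} [Ring T] {A B M : ModuleCat.{v} T}

theorem isCountablyGenerated_of_finite (A : ModuleCat.{v} T) [Module.Finite T A] :
    IsCountablyGenerated A :=
  let ⟨s, hs⟩ := (Module.Finite.fg_top : (⊤ : Submodule T A).FG)
  ⟨s, s.countable_toSet, hs⟩

theorem IsCountablyGenerated.of_surjective (hA : IsCountablyGenerated A) (f : A ⟶ B)
    (hf : Function.Surjective f) : IsCountablyGenerated B := by
  obtain ⟨s, hs, span_s⟩ := hA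
  refine ⟨f.hom '' s, hs.image _, ?_⟩
  rw [Submodule.span_image, span_s, Submodule.map_top, LinearMap.range_eq_top.2 hf]

theorem IsCountablyGenerated.of_retract (hB : IsCountablyGenerated B) (ρ : Retract A B) :
    IsCountablyGenerated A :=
  hB.of_surjective ρ.r fun a => ⟨ρ.i a, ConcreteCategory.congr_hom ρ.retract a⟩

theorem IsCountablyGenerated.copower (hA : IsCountablyGenerated A) (Λ : Type v) [Countable Λ] :
    IsCountablyGenerated (copower A Λ) := by
  obtain ⟨s, hs, span_s⟩ := hA
  refine ⟨⋃ l : Λ, Finsupp.lsingle (R := T) l '' s, Set.countable_iUnion fun l => hs.image _, ?_⟩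
  simp_rw [Submodule.span_iUnion, Submodule.span_image, span_s, Submodule.map_top]
  exact Finsupp.iSup_lsingle_range

theorem exists_countable_range_le_supported {Λ : Type w} (hA : IsCountablyGenerated A)
    (f : A →ₗ[T] Λ →₀ M) :
    ∃ s : Set Λ, s.Countable ∧ LinearMap.range f ≤ Finsupp.supported M T s := by
  obtain ⟨t, ht, span_t⟩ := hA
  refine ⟨⋃ a ∈ t, (f a).support, ht.biUnion fun a _ => (f a).support.countable_toSet, ?_⟩
  rw [← Submodule.map_top, ← span_t, Submodule.map_span_le]
  intro a ha
  exact Set.subset_biUnion_of_mem (u := fun a => ((f a).support : Set Λ)) ha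

theorem countableAddClosure_iff (hM : IsCountablyGenerated M) :
    countableAddClosure M A ↔
      ∃ Λ : Type v, Countable Λ ∧ Nonempty (Retract A (copower M Λ)) := by
  constructor
  · rintro ⟨hA, hA'⟩
    obtain ⟨Λ, ⟨ρ⟩⟩ := addClosure_iff.1 hA
    obtain ⟨s, hs, range_le⟩ := exists_countable_range_le_supported hA' ρ.i.hom
    exact ⟨s, hs, nonempty_retract_copower_of_range_le_supported s ρ range_le⟩
  · rintro ⟨Λ, _, ⟨ρ⟩⟩
    exact ⟨addClosure_iff.2 ⟨Λ, ⟨ρ⟩⟩, (hM.copower Λ).of_retract ρ⟩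

end CountablyGenerated

/-! ### Self-small modules and the ideals of `Hom_R(M, B)` -/

section Smallness

variable {T : Type u} [Ring T] {A B M X : ModuleCat.{v} T}

theorem eq_sum_of_range_le_supported {Λ : Type w} {g : A →ₗ[T] (Λ →₀ X)} {s : Finset Λ}
    (hs : LinearMap.range g ≤ Finsupp.supported X T (s : Set Λ)) :
    g = ∑ l ∈ s, Finsupp.lsingle l ∘ₗ Finsupp.lapply l ∘ₗ g := by
  ext1 a
  have supp : (g a).support ⊆ s := Finset.coe_subset.1 (hs ⟨a, rfl⟩)
  conv_lhs => rw [← (g a).sum_single, Finsupp.sum_of_support_subset _ supp _ (by simp)]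
  simp [LinearMap.sum_apply]

/-- Every homomorphism from `A` to a direct sum of copies of `X` has its image in a finite subsum.
A module is self-small if it is small relative to itself. -/
def IsSmallRelativeTo (A X : ModuleCat.{v} T) : Prop :=
  ∀ (Λ : Type v) (g : A ⟶ copower X Λ),
    ∃ s : Finset Λ, LinearMap.range g.hom ≤ Finsupp.supported X T (s : Set Λ)

theorem isSmallRelativeTo_of_finite (A X : ModuleCat.{v} T) [Module.Finite T A] :
    IsSmallRelativeTo A X := by
  classical
  intro Λ g
  obtain ⟨t, span_t⟩ := (Module.Finite.fg_top : (⊤ : Submodule T A).FG)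
  refine ⟨t.biUnion fun a => (g.hom a).support, ?_⟩
  rw [← Submodule.map_top, ← span_t, Submodule.map_span_le]
  exact fun a ha => Finset.coe_subset.2 <|
    Finset.subset_biUnion_of_mem (fun a => (g.hom a).support) ha

theorem IsSmallRelativeTo.of_addClosure (hA : IsSmallRelativeTo A M) (hX : addClosure M X) :
    IsSmallRelativeTo A X := by
  classical
  intro Λ g
  obtain ⟨K, ⟨ρ⟩⟩ := addClosure_iff.1 hX
  let σ : Retract (copower X Λ) (copower M (Λ × K)) :=
    (retractCopower ρ Λ).trans (.ofIso (copowerCopowerIso M K Λ))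
  obtain ⟨s, hs⟩ := hA (Λ × K) (g ≫ σ.i)
  refine ⟨s.image Prod.fst, ?_⟩
  rintro _ ⟨a, rfl⟩ l hl
  have hl' : ρ.i.hom (g.hom a l) ≠ 0 := fun h => Finsupp.mem_support_iff.1 hl <| by
    simpa [h, -Retract.retract] using (ConcreteCategory.congr_hom ρ.retract (g.hom a l)).symm
  obtain ⟨k, hk⟩ := Finsupp.ne_iff.1 hl'
  have hlk : (l, k) ∈ s := hs ⟨a, rfl⟩ (Finsupp.mem_support_iff.2 hk)
  exact Finset.mem_coe.2 (Finset.mem_image_of_mem Prod.fst hlk)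

theorem IsSmallRelativeTo.exists_eq_sum (h : IsSmallRelativeTo A X) {Λ : Type v}
    (g : A ⟶ copower X Λ) : ∃ s : Finset Λ, g = ∑ l ∈ s, (g ≫ copower.π l) ≫ copower.ι l := by
  obtain ⟨s, hs⟩ := h Λ g
  refine ⟨s, ModuleCat.hom_ext ?_⟩
  rw [ModuleCat.hom_sum]
  exact eq_sum_of_range_le_supported hs

end Smallness

section Ideals

variable {T : Type u} [Ring T] {A B X : ModuleCat.{v} T}

theorem factorsThroughCopower_iff {Λ : Type v} {f : A ⟶ B} :
    FactorsThroughCopower X Λ f ↔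
      ∃ (g : A ⟶ copower X Λ) (h : copower X Λ ⟶ B), f = g ≫ h :=
  ⟨fun ⟨g, h, e⟩ => ⟨ModuleCat.ofHom g, ModuleCat.ofHom h, ModuleCat.hom_ext e⟩,
    fun ⟨g, h, e⟩ => ⟨g.hom, h.hom, congrArg ModuleCat.Hom.hom e⟩⟩

theorem comp_mem_finiteIdeal (f : A ⟶ X) (g : X ⟶ B) : f ≫ g ∈ finiteIdeal X A B :=
  ⟨1, Finsupp.lsingle 0 ∘ₗ f.hom, g.hom ∘ₗ Finsupp.lapply 0, by ext; simp⟩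

theorem mem_closure_of_range_le_supported {Λ : Type w} {f : A ⟶ B} {g : A →ₗ[T] (Λ →₀ X)}
    {h : (Λ →₀ X) →ₗ[T] B} (hf : f.hom = h ∘ₗ g) {s : Finset Λ}
    (hs : LinearMap.range g ≤ Finsupp.supported X T (s : Set Λ)) :
    f ∈ AddSubgroup.closure {f : A ⟶ B | ∃ (g : A ⟶ X) (h : X ⟶ B), f = g ≫ h} := by
  have hf' : f = ∑ l ∈ s, ModuleCat.ofHom (Finsupp.lapply l ∘ₗ g) ≫
      ModuleCat.ofHom (h ∘ₗ Finsupp.lsingle l) := by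
    ext a
    conv_lhs => rw [hf, eq_sum_of_range_le_supported hs]
    simp [ModuleCat.hom_sum]
  rw [hf']
  exact AddSubgroup.sum_mem _ fun l _ => AddSubgroup.subset_closure ⟨_, _, rfl⟩

theorem finiteIdeal_eq_closure :
    finiteIdeal X A B =
      AddSubgroup.closure {f : A ⟶ B | ∃ (g : A ⟶ X) (h : X ⟶ B), f = g ≫ h} := by
  apply le_antisymm
  · rintro f ⟨n, g, h, hf⟩
    exact mem_closure_of_range_le_supported hf (s := Finset.univ) (by simp)
  · rw [AddSubgroup.closure_le]
    rintro _ ⟨g, h, rfl⟩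
    exact comp_mem_finiteIdeal g h

theorem finiteIdeal_le_infiniteIdeal : finiteIdeal X A B ≤ infiniteIdeal X A B := by
  rw [finiteIdeal_eq_closure, AddSubgroup.closure_le]
  rintro _ ⟨g, h, rfl⟩
  have factor : (g ≫ copower.ι PUnit.unit) ≫ copower.π PUnit.unit ≫ h = g ≫ h := by
    rw [Category.assoc, ← Category.assoc (copower.ι _), copower.ι_π, Category.id_comp]
  exact ⟨PUnit, factorsThroughCopower_iff.2 ⟨_, _, factor.symm⟩⟩

theorem IsSmallRelativeTo.finiteIdeal_eq_infiniteIdeal (h : IsSmallRelativeTo A X) :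
    finiteIdeal X A B = infiniteIdeal X A B := by
  refine le_antisymm finiteIdeal_le_infiniteIdeal ?_
  rintro f ⟨Λ, g, k, hf⟩
  obtain ⟨s, hs⟩ := h Λ (ModuleCat.ofHom g)
  rw [finiteIdeal_eq_closure]
  exact mem_closure_of_range_le_supported hf hs

theorem FactorsThroughCopower.sigma {Λ : Type v} {K : Λ → Type w} {f : copower A Λ ⟶ B}
    (hf : ∀ l, FactorsThroughCopower X (K l) (copower.ι l ≫ f)) :
    FactorsThroughCopower X (Σ l, K l) f := by
  choose g h hgh using hf
  refine ⟨Finsupp.lsum ℕ fun l => Finsupp.lmapDomain X T (Sigma.mk l) ∘ₗ g l,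
    Finsupp.lsum ℕ fun k => h k.1 ∘ₗ Finsupp.lsingle k.2, Finsupp.lhom_ext' fun l => ?_⟩
  have restrict : (Finsupp.lsum ℕ fun k : Σ l, K l => h k.1 ∘ₗ Finsupp.lsingle k.2) ∘ₗ
      Finsupp.lmapDomain X T (Sigma.mk l) = h l := by
    ext
    simp
  rw [LinearMap.comp_assoc, Finsupp.lsum_comp_lsingle, ← LinearMap.comp_assoc, restrict]
  exact hgh l

end Ideals

section Trace

variable {R : Type u} [Ring R] {M X B : ModuleCat.{v} Rᵐᵒᵖ}

theorem comp_mem_homTrace (f : M ⟶ X) (g : X ⟶ M) : (f ≫ g : End M) ∈ homTrace M X := by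
  let postcomp : (preadditiveCoyonedaObj M).obj X →ₗ[(End M)ᵐᵒᵖ] End M :=
    { toFun := fun p => (p : M ⟶ X) ≫ g
      map_add' := fun p q => Preadditive.add_comp _ _ _ _ _ _
      map_smul' := fun s p => Category.assoc _ _ _ }
  exact Submodule.mem_iSup_of_mem postcomp ⟨f, rfl⟩

variable (hM : IsSmallRelativeTo M M) (hX : addClosure M X)

include hM hX

/-- A dual basis for the right module `Hom(M, X)`, as far as a single element is concerned. -/
theorem exists_eq_sum_comp_of_addClosure (f : M ⟶ X) :
    ∃ (Λ : Type v) (s : Finset Λ) (a : Λ → (X ⟶ M)) (b : Λ → (M ⟶ X)),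
      f = ∑ l ∈ s, (f ≫ a l) ≫ b l := by
  obtain ⟨Λ, ⟨ρ⟩⟩ := addClosure_iff.1 hX
  obtain ⟨s, hs⟩ := hM.exists_eq_sum (f ≫ ρ.i)
  refine ⟨Λ, s, fun l => ρ.i ≫ copower.π l, fun l => copower.ι l ≫ ρ.r, ?_⟩
  calc f = (f ≫ ρ.i) ≫ ρ.r := by simp
    _ = (∑ l ∈ s, ((f ≫ ρ.i) ≫ copower.π l) ≫ copower.ι l) ≫ ρ.r := by rw [← hs]
    _ = ∑ l ∈ s, (f ≫ ρ.i ≫ copower.π l) ≫ copower.ι l ≫ ρ.r := by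
      simp only [Preadditive.sum_comp, Category.assoc]

theorem homTrace_le_finiteIdeal {s : M ⟶ M} (hs : s ∈ homTrace M X) :
    s ∈ finiteIdeal X M M := by
  refine Submodule.iSup_induction _ (motive := fun t : End M => (t : M ⟶ M) ∈ finiteIdeal X M M)
    hs ?_ (AddSubgroup.zero_mem _) fun _ _ => AddSubgroup.add_mem _
  rintro φ _ ⟨f, rfl⟩
  obtain ⟨Λ, s, a, b, hf⟩ := exists_eq_sum_comp_of_addClosure hM hX f
  have hφ : φ f = ∑ l ∈ s, (f : M ⟶ X) ≫ a l ≫ (φ (b l) : M ⟶ M) := by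
    conv_lhs => rw [hf]
    refine (map_sum φ _ _).trans (Finset.sum_congr rfl fun l _ => ?_)
    exact (φ.map_smul (op ((f : M ⟶ X) ≫ a l : End M)) _).trans (Category.assoc _ _ _)
  rw [hφ]
  exact AddSubgroup.sum_mem _ fun l _ => comp_mem_finiteIdeal _ _

theorem mem_homTrace_iff (s : M ⟶ M) : s ∈ homTrace M X ↔ s ∈ finiteIdeal X M M := by
  refine ⟨homTrace_le_finiteIdeal hM hX, fun hs => ?_⟩
  have closure_le : finiteIdeal X M M ≤ (homTrace M X).toAddSubgroup := by
    rw [finiteIdeal_eq_closure, AddSubgroup.closure_le]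
    rintro _ ⟨f, g, rfl⟩
    exact comp_mem_homTrace f g
  exact closure_le hs

theorem finiteIdeal_eq_homMulIdeal :
    finiteIdeal X M B = homMulIdeal M B (homTrace M X) := by
  apply le_antisymm
  · rw [finiteIdeal_eq_closure, AddSubgroup.closure_le]
    rintro _ ⟨f, g, rfl⟩
    obtain ⟨Λ, s, a, b, hf⟩ := exists_eq_sum_comp_of_addClosure hM hX f
    have hfg : f ≫ g = ∑ l ∈ s, (f ≫ a l) ≫ b l ≫ g := by
      conv_lhs => rw [hf]
      simp only [Preadditive.sum_comp, Category.assoc]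
    rw [hfg]
    exact AddSubgroup.sum_mem _ fun l _ =>
      AddSubgroup.subset_closure ⟨_, _, comp_mem_homTrace _ _, rfl⟩
  · rw [homMulIdeal, AddSubgroup.closure_le]
    rintro _ ⟨f, s, hs, rfl⟩
    obtain ⟨n, hs⟩ := (mem_homTrace_iff hM hX s).1 hs
    exact ⟨n, hs.comp_left f⟩

theorem infiniteIdeal_eq_homMulIdeal : infiniteIdeal X M B = homMulIdeal M B (homTrace M X) := by
  rw [← (hM.of_addClosure hX).finiteIdeal_eq_infiniteIdeal, finiteIdeal_eq_homMulIdeal hM hX]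

end Trace

/-! ### The tensor product `P ⊗_S S/I` -/

namespace BalancedTensor

section Lift

variable {S U N P G : Type*} [Ring S] [Ring U] [AddCommGroup N] [Module S N] [Module Uᵐᵒᵖ N]
  [SMulCommClass S Uᵐᵒᵖ N] [AddCommGroup P] [Module Sᵐᵒᵖ P] [AddCommGroup G]

/-- The additive map out of `P ⊗_S N` given by a balanced biadditive map. -/
def lift (φ : N →+ P →+ G) (balanced : ∀ (n : N) (s : S) (p : P), φ n (op s • p) = φ (s • n) p) :
    BalancedTensor S U N P →+ G :=
  QuotientAddGroup.lift (balancedRelations S U N P).toAddSubgroup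
    (TensorProduct.liftAddHom φ fun k n p => by simp) <| by
      intro t ht
      induction ht using Submodule.closure_induction with
      | zero => exact zero_mem _
      | add _ _ _ _ hx hy => exact add_mem hx hy
      | smul_mem u _ hx =>
        obtain ⟨n, s, p, rfl⟩ := hx
        simp [AddMonoidHom.mem_ker, smul_sub, TensorProduct.smul_tmul', balanced, smul_comm s u n]

end Lift

variable {S : Type*} [Ring S] (I : Ideal S) [I.IsTwoSided] {P : Type*} [AddCommGroup P]
  [Module Sᵐᵒᵖ P]

/-- The additive map `p ↦ p ⊗ 1` from `P` to `P ⊗_S S/I`. -/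
def mk : P →+ BalancedTensor S (S ⧸ I) (S ⧸ I) P where
  toFun p := Submodule.Quotient.mk ((1 : S ⧸ I) ⊗ₜ[ℤ] p)
  map_zero' := by rw [TensorProduct.tmul_zero, Submodule.Quotient.mk_zero]
  map_add' p q := by rw [TensorProduct.tmul_add, Submodule.Quotient.mk_add]

theorem mk_op_smul (s : S) (p : P) :
    mk I (op s • p) = Submodule.Quotient.mk (Ideal.Quotient.mk I s ⊗ₜ[ℤ] p) := by
  refine (Submodule.Quotient.eq _).2 (Submodule.subset_span ⟨1, s, p, ?_⟩)
  congr 2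
  exact congrArg (Ideal.Quotient.mk I) (mul_one s).symm

theorem op_smul_mk (s : S) (p : P) : op (Ideal.Quotient.mk I s) • mk I p = mk I (op s • p) := by
  refine Eq.trans ?_ (mk_op_smul I s p).symm
  change Submodule.Quotient.mk ((1 * Ideal.Quotient.mk I s) ⊗ₜ[ℤ] p) = _
  rw [one_mul]

theorem mk_surjective : Function.Surjective (mk I (P := P)) := by
  intro x
  obtain ⟨x, rfl⟩ := Submodule.Quotient.mk_surjective _ x
  induction x using TensorProduct.induction_on with
  | zero => exact ⟨0, map_zero _⟩
  | tmul n p =>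
    obtain ⟨s, rfl⟩ := Ideal.Quotient.mk_surjective n
    exact ⟨_, mk_op_smul I s p⟩
  | add x y hx hy =>
    obtain ⟨⟨p, hp⟩, ⟨q, hq⟩⟩ := And.intro hx hy
    exact ⟨p + q, by rw [map_add, hp, hq, Submodule.Quotient.mk_add]⟩

/-- The subgroup `P I` of a right module `P`. -/
def rightMulIdeal (P : Type*) [AddCommGroup P] [Module Sᵐᵒᵖ P] : AddSubgroup P :=
  AddSubgroup.closure {q | ∃ (p : P) (s : S), s ∈ I ∧ q = op s • p}

/-- The additive map `p ⊗ s ↦ p s` from `P ⊗_S S/I` to `P / P I`. -/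
def toQuotient : BalancedTensor S (S ⧸ I) (S ⧸ I) P →+ P ⧸ rightMulIdeal I P :=
  lift
    (QuotientAddGroup.lift (Submodule.toAddSubgroup I)
      { toFun s := (QuotientAddGroup.mk' (rightMulIdeal I P)).comp
          (DistribSMul.toAddMonoidHom P (op s))
        map_zero' := by ext; simp
        map_add' s t := by ext; simp [add_smul] }
      fun s hs => by
        ext p
        exact (QuotientAddGroup.eq_zero_iff _).2 (AddSubgroup.subset_closure ⟨p, s, hs, rfl⟩))
    fun n s p => by
      obtain ⟨n, rfl⟩ := Ideal.Quotient.mk_surjective n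
      exact congrArg _ ((mul_smul (op n) (op s) p).symm)

theorem toQuotient_mk (p : P) : toQuotient I (mk I p) = QuotientAddGroup.mk p :=
  congrArg _ (one_smul _ p)

theorem mk_eq_zero_iff (p : P) : mk I p = 0 ↔ p ∈ rightMulIdeal I P := by
  constructor
  · intro h
    rw [← QuotientAddGroup.eq_zero_iff, ← toQuotient_mk I p, h, map_zero]
  · suffices h : rightMulIdeal I P ≤ (mk I).ker from fun hp => h hp
    refine (AddSubgroup.closure_le _).2 ?_
    rintro _ ⟨p, s, hs, rfl⟩
    change mk I (op s • p) = 0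
    rw [← op_smul_mk, Ideal.Quotient.eq_zero_iff_mem.2 hs, MulOpposite.op_zero, zero_smul]

end BalancedTensor

section HomTensor

variable {R : Type u} [Ring R] {M : ModuleCat.{v} Rᵐᵒᵖ} (I : Ideal (End M)) [I.IsTwoSided]
  {A B : ModuleCat.{v} Rᵐᵒᵖ}

/-- The additive map `p ↦ p ⊗ 1` from `Hom_R(M, B)` to `Hom_R(M, B) ⊗_S S/I`. -/
def homTensorMk : (M ⟶ B) →+ (homTensor M I).obj B :=
  let p : (preadditiveCoyonedaObj M).obj B →+ BalancedTensor (End M) (End M ⧸ I) (End M ⧸ I)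
    ((preadditiveCoyonedaObj M).obj B) := BalancedTensor.mk I
  p

theorem homTensorMk_surjective : Function.Surjective (homTensorMk I (B := B)) :=
  BalancedTensor.mk_surjective I

theorem op_smul_homTensorMk (s : End M) (p : M ⟶ B) :
    op (Ideal.Quotient.mk I s) • homTensorMk I p = homTensorMk I ((s : M ⟶ M) ≫ p) :=
  BalancedTensor.op_smul_mk I (P := (preadditiveCoyonedaObj M).obj B) s p

theorem homTensorMk_eq_zero_iff (p : M ⟶ B) :
    homTensorMk I p = 0 ↔ p ∈ homMulIdeal M B I :=
  BalancedTensor.mk_eq_zero_iff I (P := (preadditiveCoyonedaObj M).obj B) p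

theorem homTensor_map_homTensorMk (f : A ⟶ B) (p : M ⟶ A) :
    (homTensor M I).map f (homTensorMk I p) = homTensorMk I (p ≫ f) := rfl

theorem homTensor_hom_ext {N : ModuleCat.{v} (End M ⧸ I)ᵐᵒᵖ} {f g : (homTensor M I).obj A ⟶ N}
    (h : ∀ p : M ⟶ A, f (homTensorMk I p) = g (homTensorMk I p)) : f = g := by
  refine ModuleCat.hom_ext (LinearMap.ext fun x => ?_)
  obtain ⟨p, rfl⟩ := homTensorMk_surjective I x
  exact h p

instance homTensor_additive : (homTensor M I).Additive where
  map_add {A B f g} := homTensor_hom_ext I fun p => by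
    change homTensorMk I (p ≫ (f + g)) = homTensorMk I (p ≫ f) + homTensorMk I (p ≫ g)
    rw [Preadditive.comp_add, map_add]

end HomTensor

/-! ### Morphisms between the modules `Hom_R(M, A) ⊗_S S/I` -/

section Comparison

variable {T : Type u} [Ring T] {U : Type w} [Ring U] (F : ModuleCat.{v} T ⥤ ModuleCat.{v} U)
  (A : ModuleCat.{v} T) {Λ : Type v}

/-- The canonical homomorphism `F(A)^(Λ) ⟶ F(A^(Λ))`. -/
noncomputable def copowerComparison (Λ : Type v) : copower (F.obj A) Λ ⟶ F.obj (copower A Λ) :=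
  copower.desc fun l => F.map (copower.ι l)

@[simp]
theorem ι_copowerComparison (l : Λ) :
    copower.ι l ≫ copowerComparison F A Λ = F.map (copower.ι l) :=
  copower.ι_desc _ l

theorem copowerComparison_map_π [F.Additive] (l : Λ) :
    copowerComparison F A Λ ≫ F.map (copower.π l) = copower.π l := by
  refine copower.hom_ext fun k => ?_
  rw [← Category.assoc, ι_copowerComparison, ← F.map_comp]
  obtain rfl | h := eq_or_ne k l
  · rw [copower.ι_π, copower.ι_π, F.map_id]
  · rw [copower.ι_π_of_ne h, copower.ι_π_of_ne h, F.map_zero]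

theorem copowerComparison_injective [F.Additive] (Λ : Type v) :
    Function.Injective (copowerComparison F A Λ) := by
  intro x y h
  refine Finsupp.ext fun l => ?_
  have hl := congrArg (F.map (copower.π l)) h
  rwa [← ConcreteCategory.comp_apply, ← ConcreteCategory.comp_apply,
    copowerComparison_map_π] at hl

end Comparison

section FreeModules

variable {R : Type u} [Ring R] {M : ModuleCat.{v} Rᵐᵒᵖ} (I : Ideal (End M)) [I.IsTwoSided]
  {A B : ModuleCat.{v} Rᵐᵒᵖ}

theorem IsSmallRelativeTo.copowerComparison_homTensor_surjective (h : IsSmallRelativeTo M A)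
    (Λ : Type v) : Function.Surjective (copowerComparison (homTensor M I) A Λ) := by
  intro x
  obtain ⟨p, rfl⟩ := homTensorMk_surjective I x
  obtain ⟨s, hp⟩ := h.exists_eq_sum p
  refine ⟨∑ l ∈ s, copower.ι l (homTensorMk I (p ≫ copower.π l)), ?_⟩
  conv_rhs => rw [hp, map_sum]
  rw [map_sum]
  refine Finset.sum_congr rfl fun l _ => ?_
  rw [← ConcreteCategory.comp_apply, ι_copowerComparison, homTensor_map_homTensorMk]

theorem IsSmallRelativeTo.isIso_copowerComparison_homTensor (h : IsSmallRelativeTo M A)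
    (Λ : Type v) : IsIso (copowerComparison (homTensor M I) A Λ) :=
  (ConcreteCategory.isIso_iff_bijective _).2
    ⟨copowerComparison_injective _ A Λ, h.copowerComparison_homTensor_surjective I Λ⟩

omit [I.IsTwoSided] in
theorem mem_homMulIdeal_self_iff {s : End M} : s ∈ homMulIdeal M M I ↔ s ∈ I := by
  refine ⟨fun hs => ?_, fun hs =>
    AddSubgroup.subset_closure ⟨𝟙 M, s, hs, (Category.comp_id s).symm⟩⟩
  suffices h : homMulIdeal M M I ≤ Submodule.toAddSubgroup I from h hs
  refine (AddSubgroup.closure_le _).2 ?_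
  rintro _ ⟨f, t, ht, rfl⟩
  exact I.mul_mem_left (f : End M) ht

/-- The homomorphism `s ↦ s ⊗ 1` of right modules from `S/I` to `Hom_R(M, M) ⊗_S S/I`. -/
def regularToHomTensor : (End M ⧸ I) →ₗ[(End M ⧸ I)ᵐᵒᵖ] (homTensor M I).obj M :=
  LinearMap.toSpanSingleton (End M ⧸ I)ᵐᵒᵖ ((homTensor M I).obj M) (homTensorMk I (𝟙 M)) ∘ₗ
    (opLinearEquiv (End M ⧸ I)ᵐᵒᵖ).toLinearMap

theorem regularToHomTensor_mk (s : End M) :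
    regularToHomTensor I (Ideal.Quotient.mk I s) = homTensorMk I s :=
  (op_smul_homTensorMk I s (𝟙 M)).trans (congrArg _ (Category.comp_id s))

theorem regularToHomTensor_bijective : Function.Bijective (regularToHomTensor I) := by
  constructor
  · rw [injective_iff_map_eq_zero]
    intro x hx
    obtain ⟨s, rfl⟩ := Ideal.Quotient.mk_surjective x
    rw [regularToHomTensor_mk, homTensorMk_eq_zero_iff, mem_homMulIdeal_self_iff] at hx
    exact Ideal.Quotient.eq_zero_iff_mem.2 hx
  · intro y
    obtain ⟨s, rfl⟩ := homTensorMk_surjective I y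
    exact ⟨Ideal.Quotient.mk I s, regularToHomTensor_mk I s⟩

/-- The isomorphism `S/I ≅ Hom_R(M, M) ⊗_S S/I` of right `S/I`-modules. -/
noncomputable def regularIsoHomTensor :
    ModuleCat.of (End M ⧸ I)ᵐᵒᵖ (End M ⧸ I) ≅ (homTensor M I).obj M :=
  (LinearEquiv.ofBijective _ (regularToHomTensor_bijective I)).toModuleIso

/-- The functor `Hom_R(M, -) ⊗_S S/I` maps `M^(Λ)` to `(S/I)^(Λ)`, if `M` is self-small. -/
noncomputable def homTensorCopowerIso (hM : IsSmallRelativeTo M M) (Λ : Type v) :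
    (homTensor M I).obj (copower M Λ) ≅
      copower (ModuleCat.of (End M ⧸ I)ᵐᵒᵖ (End M ⧸ I)) Λ :=
  have := hM.isIso_copowerComparison_homTensor I Λ
  (asIso (copowerComparison (homTensor M I) M Λ)).symm ≪≫
    (Finsupp.mapRange.linearEquiv (regularIsoHomTensor I).symm.toLinearEquiv).toModuleIso

/-- The functor `Hom_R(M, -) ⊗_S S/I` maps retracts of `M^(Λ)` to retracts of `(S/I)^(Λ)`, if `M`
is self-small. -/
noncomputable def homTensorRetract (hM : IsSmallRelativeTo M M) {Λ : Type v}
    (ρ : Retract A (copower M Λ)) :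
    Retract ((homTensor M I).obj A) (copower (ModuleCat.of (End M ⧸ I)ᵐᵒᵖ (End M ⧸ I)) Λ) :=
  (ρ.map (homTensor M I)).trans (.ofIso (homTensorCopowerIso I hM Λ))

theorem homTensor_map_surjective_of_self (φ : (homTensor M I).obj M ⟶ (homTensor M I).obj B) :
    ∃ f : M ⟶ B, (homTensor M I).map f = φ := by
  obtain ⟨f, hf⟩ := homTensorMk_surjective I (φ (homTensorMk I (𝟙 M)))
  refine ⟨f, homTensor_hom_ext I fun p => ?_⟩
  rw [homTensor_map_homTensorMk, ← op_smul_homTensorMk, hf, ← map_smul, op_smul_homTensorMk,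
    Category.comp_id]

theorem homTensor_map_surjective_of_copower (hM : IsSmallRelativeTo M M) {Λ : Type v}
    (φ : (homTensor M I).obj (copower M Λ) ⟶ (homTensor M I).obj B) :
    ∃ f : copower M Λ ⟶ B, (homTensor M I).map f = φ := by
  have := hM.isIso_copowerComparison_homTensor I Λ
  choose f hf using fun l : Λ =>
    homTensor_map_surjective_of_self I ((homTensor M I).map (copower.ι l) ≫ φ)
  refine ⟨copower.desc f, ?_⟩
  rw [← cancel_epi (copowerComparison (homTensor M I) M Λ)]
  refine copower.hom_ext fun l => ?_
  rw [← Category.assoc, ← Category.assoc, ι_copowerComparison, ← Functor.map_comp, copower.ι_desc,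
    hf]

theorem homTensor_map_surjective (hM : IsSmallRelativeTo M M) (hA : addClosure M A)
    (φ : (homTensor M I).obj A ⟶ (homTensor M I).obj B) :
    ∃ f : A ⟶ B, (homTensor M I).map f = φ := by
  obtain ⟨Λ, ⟨ρ⟩⟩ := addClosure_iff.1 hA
  obtain ⟨f, hf⟩ := homTensor_map_surjective_of_copower I hM ((homTensor M I).map ρ.r ≫ φ)
  refine ⟨ρ.i ≫ f, ?_⟩
  rw [Functor.map_comp, hf, ← Category.assoc, ← Functor.map_comp, ρ.retract,
    CategoryTheory.Functor.map_id, Category.id_comp]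

end FreeModules

section Kernel

variable {R : Type u} [Ring R] {M X : ModuleCat.{v} Rᵐᵒᵖ} {A B : ModuleCat.{v} Rᵐᵒᵖ}
  (hM : IsSmallRelativeTo M M) (hX : addClosure M X)

include hM hX

theorem homTensor_map_eq_zero_of_mem {f : A ⟶ B} (hf : f ∈ infiniteIdeal X A B) :
    (homTensor M (homTrace M X)).map f = 0 := by
  obtain ⟨Λ, hf⟩ := hf
  refine homTensor_hom_ext _ fun p => ?_
  refine (homTensorMk_eq_zero_iff _ (p ≫ f)).2 ?_
  rw [← infiniteIdeal_eq_homMulIdeal hM hX]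
  exact ⟨Λ, hf.comp_right p⟩

/-- The finiteness of the index sets keeps track of the cardinality in the countable case. -/
theorem exists_factorsThroughCopower_of_homTensor_map_eq_zero {Λ : Type v} {f : copower M Λ ⟶ B}
    (hf : (homTensor M (homTrace M X)).map f = 0) :
    ∃ n : Λ → ℕ, FactorsThroughCopower X (Σ l, Fin (n l)) f := by
  have component (l : Λ) : copower.ι l ≫ f ∈ finiteIdeal X M B := by
    rw [finiteIdeal_eq_homMulIdeal hM hX, ← homTensorMk_eq_zero_iff, ← homTensor_map_homTensorMk,
      hf]
    rfl
  choose n hn using component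
  exact ⟨n, .sigma hn⟩

theorem homTensor_map_eq_zero_iff (hA : addClosure M A) {f : A ⟶ B} :
    (homTensor M (homTrace M X)).map f = 0 ↔ f ∈ infiniteIdeal X A B := by
  refine ⟨fun hf => ?_, homTensor_map_eq_zero_of_mem hM hX⟩
  obtain ⟨Λ, ⟨ρ⟩⟩ := addClosure_iff.1 hA
  obtain ⟨n, hn⟩ := exists_factorsThroughCopower_of_homTensor_map_eq_zero hM hX (f := ρ.r ≫ f)
    (by rw [Functor.map_comp, hf, comp_zero])
  have hf' : f = ρ.i ≫ ρ.r ≫ f := by simp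
  exact hf' ▸ ⟨_, hn.comp_right ρ.i⟩

end Kernel

/-! ### The Eilenberg swindle -/

section Splittings

variable {C D : Type*} [Category* C] [Category* D]

theorem nonempty_iso_of_retract {A B Z : C} (ρ : Retract A Z) (σ : Retract B Z)
    (h : ρ.r ≫ ρ.i = σ.r ≫ σ.i) : Nonempty (A ≅ B) :=
  ⟨⟨ρ.i ≫ σ.r, σ.i ≫ ρ.r,
    by rw [Category.assoc, ← Category.assoc σ.r, ← h]; simp,
    by rw [Category.assoc, ← Category.assoc ρ.r, h]; simp⟩⟩

variable [Preadditive C] [Preadditive D] (F : C ⥤ D) [F.Additive]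

/-- By `split`, `W` is a retract of `W ⊞ Y`; its complement is `A`, and `F` does not see `Y`. -/
theorem exists_retract_biprod_of_isZero_map [IsIdempotentComplete C] [HasBinaryBiproducts C]
    {W Y : C} {s p : W ⟶ W} {g : W ⟶ Y} {h : Y ⟶ W} (split : s ≫ p + g ≫ h = 𝟙 W)
    (hY : IsZero (F.obj Y)) :
    ∃ (A : C) (_ : Retract A (W ⊞ Y)) (σ : Retract (F.obj A) (F.obj W)),
      σ.r ≫ σ.i = 𝟙 (F.obj W) - F.map (p ≫ s) := by
  let m : W ⟶ W ⊞ Y := biprod.lift s g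
  let q : W ⊞ Y ⟶ W := biprod.desc p h
  have mq : m ≫ q = 𝟙 W := by rw [biprod.lift_desc, split]
  obtain ⟨A, i, r, ir, ri⟩ := IsIdempotentComplete.idempotents_split (W ⊞ Y) (𝟙 _ - q ≫ m) <| by
    simp [Preadditive.comp_sub, Preadditive.sub_comp, reassoc_of% mq]
  have fst_inl : F.map (biprod.fst : W ⊞ Y ⟶ W) ≫ F.map biprod.inl = 𝟙 _ := by
    have snd_inr : F.map ((biprod.snd : W ⊞ Y ⟶ Y) ≫ (biprod.inr : Y ⟶ W ⊞ Y)) = 0 := by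
      rw [F.map_comp, hY.eq_zero_of_tgt (F.map _), zero_comp]
    rw [← F.map_comp, ← F.map_id, ← biprod.total, F.map_add, snd_inr, add_zero]
  have inl_fst : biprod.inl ≫ (q ≫ m) ≫ biprod.fst = p ≫ s := by simp [q, m]
  refine ⟨A, ⟨i, r, ir⟩, ⟨F.map i ≫ F.map biprod.fst, F.map biprod.inl ≫ F.map r, ?_⟩, ?_⟩
  · rw [Category.assoc, reassoc_of% fst_inl, ← F.map_comp, ir, F.map_id]
  · simp only [Category.assoc, ← F.map_comp]
    rw [reassoc_of% ri, Preadditive.sub_comp, Preadditive.comp_sub, inl_fst, Category.id_comp,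
      biprod.inl_fst, F.map_sub, F.map_id]

end Splittings

section Swindle

theorem perturbedShift_mul {E : Type*} [Ring E] {e u : E} (d : E) (hu : Commute e u) :
    (1 - e + e * u) * (1 - e + e * d) =
      1 - (e - e * e) * (2 - u - d) - e * e * (1 - u * d) := by
  have hue : u * (e * d) = e * (u * d) := hu.symm.left_comm d
  simp only [mul_add, add_mul, mul_sub, sub_mul, mul_assoc, one_mul, mul_one, hu.symm.eq, hue]
  noncomm_ring

variable {C : Type*} [Category* C] [Preadditive C] [HasCoproductsOfShape ℕ C]

/-- The coproduct `L^(ℕ)` of countably many copies of `L`. -/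
noncomputable abbrev natCopower (L : C) : C := ∐ fun _ : ℕ => L

/-- The homomorphism `f^(ℕ)`. -/
noncomputable def natCopowerMap {L L' : C} (f : L ⟶ L') : natCopower L ⟶ natCopower L' :=
  Limits.Sigma.map fun _ => f

omit [Preadditive C] in
theorem natCopowerMap_comp {L L' L'' : C} (f : L ⟶ L') (g : L' ⟶ L'') :
    natCopowerMap (f ≫ g) = natCopowerMap f ≫ natCopowerMap g :=
  Sigma.hom_ext _ _ fun n => by simp [natCopowerMap]

theorem natCopowerMap_sub {L L' : C} (f g : L ⟶ L') :
    natCopowerMap (f - g) = natCopowerMap f - natCopowerMap g :=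
  Sigma.hom_ext _ _ fun n => by simp [natCopowerMap, Preadditive.comp_sub]

/-- The homomorphism `f^(ℕ)`, as an element of the endomorphism ring. -/
noncomputable def natCopowerEnd {L : C} (f : L ⟶ L) : End (natCopower L) := natCopowerMap f

/-- The endomorphism `(x₀, x₁, …) ↦ (0, x₀, x₁, …)` of `L^(ℕ)`. -/
noncomputable def shiftUp (L : C) : End (natCopower L) :=
  Sigma.desc fun n => Sigma.ι (fun _ : ℕ => L) (n + 1)

/-- The endomorphism `(x₀, x₁, …) ↦ (x₁, x₂, …)` of `L^(ℕ)`. -/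
noncomputable def shiftDown (L : C) : End (natCopower L) :=
  Sigma.desc fun
    | 0 => 0
    | n + 1 => Sigma.ι (fun _ : ℕ => L) n

/-- The first summand of `L^(ℕ)`. -/
@[simps]
noncomputable def headRetract (L : C) : Retract L (natCopower L) where
  i := Sigma.ι (fun _ : ℕ => L) 0
  r := Sigma.desc fun
    | 0 => 𝟙 L
    | _ + 1 => 0

/-- The endomorphism `(x₀, x₁, …) ↦ (x₀, 0, …)` of `L^(ℕ)`. -/
noncomputable def headProjection (L : C) : End (natCopower L) :=
  (headRetract L).r ≫ (headRetract L).i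

variable {L : C}

theorem shiftDown_mul_shiftUp : shiftDown L * shiftUp L = 1 :=
  Sigma.hom_ext _ _ fun n => by simp [End.mul_def, shiftUp, shiftDown]

theorem shiftUp_mul_shiftDown : shiftUp L * shiftDown L = 1 - headProjection L := by
  suffices h : shiftDown L ≫ shiftUp L = 𝟙 _ - (headRetract L).r ≫ (headRetract L).i from h
  exact Sigma.hom_ext _ _ fun n => by
    cases n <;> simp [shiftUp, shiftDown, Preadditive.comp_sub]

omit [Preadditive C] in
theorem natCopowerEnd_commute_shiftUp (f : L ⟶ L) : Commute (natCopowerEnd f) (shiftUp L) :=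
  Sigma.hom_ext _ _ fun n => by simp [End.mul_def, shiftUp, natCopowerEnd, natCopowerMap]

theorem natCopowerEnd_commute_shiftDown (f : L ⟶ L) : Commute (natCopowerEnd f) (shiftDown L) :=
  Sigma.hom_ext _ _ fun n => by
    cases n <;> simp [End.mul_def, shiftDown, natCopowerEnd, natCopowerMap]

theorem headRetract_i_natCopowerMap (f : L ⟶ L) :
    (headRetract L).i ≫ natCopowerMap f = f ≫ (headRetract L).i := by
  simp [natCopowerMap]

/-- The endomorphism `1 - e + e u` of `L^(ℕ)`, where `e = ε^(ℕ)` and `u` is `shiftUp`: it acts as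
the shift on the image of `e` when `ε` is idempotent, and as the identity on its kernel. -/
noncomputable def partialShiftUp (ε : L ⟶ L) : End (natCopower L) :=
  1 - natCopowerEnd ε + natCopowerEnd ε * shiftUp L

/-- The endomorphism `1 - e + e d` of `L^(ℕ)`, where `e = ε^(ℕ)` and `d` is `shiftDown`. -/
noncomputable def partialShiftDown (ε : L ⟶ L) : End (natCopower L) :=
  1 - natCopowerEnd ε + natCopowerEnd ε * shiftDown L

/-- The endomorphism `2 - u - d` of `L^(ℕ)`, where `u` and `d` are the shifts. -/
noncomputable def shiftDefect (L : C) : End (natCopower L) := 2 - shiftUp L - shiftDown L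

theorem natCopowerEnd_sub_mul_self (ε : L ⟶ L) :
    natCopowerEnd ε - natCopowerEnd ε * natCopowerEnd ε = natCopowerEnd (ε - ε ≫ ε) := by
  unfold natCopowerEnd
  rw [natCopowerMap_sub, natCopowerMap_comp]
  rfl

theorem partialShiftUp_comp_partialShiftDown (ε : L ⟶ L) :
    partialShiftUp ε ≫ partialShiftDown ε = 𝟙 _ - shiftDefect L ≫ natCopowerMap (ε - ε ≫ ε) := by
  have mul_eq : partialShiftDown ε * partialShiftUp ε =
      1 - natCopowerEnd (ε - ε ≫ ε) * shiftDefect L := by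
    unfold partialShiftDown partialShiftUp shiftDefect
    rw [perturbedShift_mul _ (natCopowerEnd_commute_shiftDown ε), shiftDown_mul_shiftUp, sub_self,
      mul_zero, sub_zero, natCopowerEnd_sub_mul_self, sub_right_comm]
  exact mul_eq

theorem partialShiftDown_comp_partialShiftUp (ε : L ⟶ L) :
    partialShiftDown ε ≫ partialShiftUp ε = 𝟙 _ - shiftDefect L ≫ natCopowerMap (ε - ε ≫ ε) -
      (headRetract L).r ≫ ε ≫ ε ≫ (headRetract L).i := by
  have mul_eq : partialShiftUp ε * partialShiftDown ε =
      1 - natCopowerEnd (ε - ε ≫ ε) * shiftDefect L -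
        natCopowerEnd ε * natCopowerEnd ε * headProjection L := by
    unfold partialShiftDown partialShiftUp shiftDefect
    rw [perturbedShift_mul _ (natCopowerEnd_commute_shiftUp ε), shiftUp_mul_shiftDown,
      sub_sub_cancel, natCopowerEnd_sub_mul_self]
  have head : ((headRetract L).r ≫ (headRetract L).i) ≫ natCopowerMap ε ≫ natCopowerMap ε =
      (headRetract L).r ≫ ε ≫ ε ≫ (headRetract L).i := by
    simp only [Category.assoc, reassoc_of% (headRetract_i_natCopowerMap ε),
      headRetract_i_natCopowerMap]
  rw [← head]
  exact mul_eq

/-- Modulo `ε - ε²`, the map `partialShiftUp ε` is a split monomorphism of `L^(ℕ)` whose complement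
is the image of `ε` on the first summand. -/
theorem exists_retract_natCopower_biprod_of_map_splits {D : Type*} [Category* D] [Preadditive D]
    [IsIdempotentComplete C] [HasBinaryBiproducts C] (F : C ⥤ D) [F.Additive] {Y : C} {N : D}
    (ρ : Retract N (F.obj L)) {ε : L ⟶ L} (hε : F.map ε = ρ.r ≫ ρ.i) {g : L ⟶ Y} {h : Y ⟶ L}
    (hgh : g ≫ h = ε - ε ≫ ε) (hY : IsZero (F.obj (natCopower Y))) :
    ∃ A : C, Nonempty (Retract A (natCopower L ⊞ natCopower Y)) ∧ Nonempty (F.obj A ≅ N) := by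
  have split : partialShiftUp ε ≫ partialShiftDown ε +
      (shiftDefect L ≫ natCopowerMap g) ≫ natCopowerMap h = 𝟙 _ := by
    rw [Category.assoc, ← natCopowerMap_comp, hgh, partialShiftUp_comp_partialShiftDown,
      sub_add_cancel]
  have map_defect : F.map (natCopowerMap (ε - ε ≫ ε)) = 0 := by
    rw [← hgh, natCopowerMap_comp, F.map_comp, hY.eq_zero_of_tgt (F.map _), zero_comp]
  obtain ⟨A, κ, σ, hσ⟩ := exists_retract_biprod_of_isZero_map F split hY
  refine ⟨A, ⟨κ⟩, nonempty_iso_of_retract σ (ρ.trans ((headRetract L).map F)) ?_⟩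
  rw [hσ, partialShiftDown_comp_partialShiftUp, F.map_sub, F.map_sub, F.map_comp (shiftDefect L),
    map_defect]
  simp [hε]

end Swindle

/-! ### The equivalences -/

section Lifting

/-- The categorical coproduct of countably many copies of `A` is a direct summand of the direct
sum `A^(ℕ)`; the indices are lifted to the universe of `A`. -/
noncomputable def retractNatCopower {T : Type u} [Ring T] (A : ModuleCat.{v} T) :
    Retract (natCopower A) (copower A (ULift.{v} ℕ)) where
  i := Limits.Sigma.desc fun n => copower.ι ⟨n⟩
  r := copower.desc fun n => Sigma.ι (fun _ : ℕ => A) n.down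
  retract := Sigma.hom_ext _ _ fun n => by simp

/-- The biproduct of two retracts. -/
noncomputable def retractBiprod {C : Type*} [Category* C] [HasZeroMorphisms C]
    [HasBinaryBiproducts C] {A A' B B' : C} (ρ : Retract A B) (σ : Retract A' B') :
    Retract (A ⊞ A') (B ⊞ B') where
  i := biprod.map ρ.i σ.i
  r := biprod.map ρ.r σ.r

variable {R : Type u} [Ring R] {M X : ModuleCat.{v} Rᵐᵒᵖ}

theorem isZero_homTensor_natCopower (hM : IsSmallRelativeTo M M) (hX : addClosure M X)
    (K : Type v) : IsZero ((homTensor M (homTrace M X)).obj (natCopower (copower X K))) := by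
  let ρ : Retract (natCopower (copower X K)) (copower X (ULift.{v} ℕ × K)) :=
    (retractNatCopower _).trans (.ofIso (copowerCopowerIso X K (ULift ℕ)))
  rw [IsZero.iff_id_eq_zero, ← CategoryTheory.Functor.map_id]
  exact homTensor_map_eq_zero_of_mem hM hX
    ⟨_, factorsThroughCopower_iff.2 ⟨ρ.i, ρ.r, ρ.retract.symm⟩⟩

theorem exists_homTensor_obj_iso (hM : IsSmallRelativeTo M M) {Λ' : Type v}
    (ρ : Retract X (copower M Λ')) {Λ : Type v}
    {N : ModuleCat.{v} (End M ⧸ homTrace M X)ᵐᵒᵖ}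
    (σ : Retract N (copower (ModuleCat.of (End M ⧸ homTrace M X)ᵐᵒᵖ (End M ⧸ homTrace M X)) Λ)) :
    ∃ (Λ'' : Type v) (A : ModuleCat.{v} Rᵐᵒᵖ),
      (Countable Λ → Countable Λ' → Countable Λ'') ∧ Nonempty (Retract A (copower M Λ'')) ∧
        Nonempty ((homTensor M (homTrace M X)).obj A ≅ N) := by
  have hX : addClosure M X := addClosure_iff.2 ⟨Λ', ⟨ρ⟩⟩
  let F := homTensor M (homTrace M X)
  let τ : Retract N (F.obj (copower M Λ)) :=
    σ.trans (.ofIso (homTensorCopowerIso (homTrace M X) hM Λ).symm)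
  obtain ⟨ε, hε⟩ := homTensor_map_surjective_of_copower (homTrace M X) hM (τ.r ≫ τ.i)
  have map_sub_eq_zero : F.map (ε - ε ≫ ε) = 0 := by
    rw [F.map_sub, F.map_comp, hε]
    simp
  obtain ⟨n, hn⟩ := exists_factorsThroughCopower_of_homTensor_map_eq_zero hM hX map_sub_eq_zero
  obtain ⟨g, h, hgh⟩ := factorsThroughCopower_iff.1 hn
  obtain ⟨A, ⟨κ⟩, iso⟩ := exists_retract_natCopower_biprod_of_map_splits F τ hε hgh.symm
    (isZero_homTensor_natCopower hM hX _)
  let L := retractNatCopower (copower M Λ)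
  let Y := (retractNatCopower (copower X (Σ l, Fin (n l)))).trans <|
    (Retract.ofIso (copowerCopowerIso X _ _)).trans (retractCopower ρ _)
  let incl := (retractBiprod (L.trans (.ofIso (copowerCopowerIso M _ _)))
    (Y.trans (.ofIso (copowerCopowerIso M _ _)))).trans (.ofIso (biprodCopowerIso M _ _))
  exact ⟨_, A, fun _ _ => inferInstance, ⟨κ.trans incl⟩, iso⟩

end Lifting

section Projective

variable {S : Type v} [Ring S]

theorem projective_iff_addClosure {N : ModuleCat.{v} Sᵐᵒᵖ} :
    Module.Projective Sᵐᵒᵖ N ↔ addClosure (ModuleCat.of Sᵐᵒᵖ S) N := by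
  let free (Λ : Type v) : (Λ →₀ Sᵐᵒᵖ) ≃ₗ[Sᵐᵒᵖ] (Λ →₀ S) :=
    Finsupp.mapRange.linearEquiv (opLinearEquiv Sᵐᵒᵖ).symm
  rw [addClosure_iff]
  constructor
  · intro hN
    obtain ⟨i, hi⟩ := Module.projective_def'.1 hN
    let ρ : Retract N (ModuleCat.of Sᵐᵒᵖ (N →₀ Sᵐᵒᵖ)) :=
      ⟨ModuleCat.ofHom i, ModuleCat.ofHom (Finsupp.linearCombination Sᵐᵒᵖ id), ModuleCat.hom_ext hi⟩
    exact ⟨N, ⟨ρ.trans (.ofIso (free N).toModuleIso)⟩⟩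
  · rintro ⟨Λ, ⟨ρ⟩⟩
    have : Module.Projective Sᵐᵒᵖ (Λ →₀ S) := .of_equiv (free Λ)
    exact .of_split (M := Λ →₀ S) ρ.i.hom ρ.r.hom (congrArg ModuleCat.Hom.hom ρ.retract)

theorem isCountablyGenerated_regular (S : Type v) [Ring S] :
    IsCountablyGenerated (ModuleCat.of Sᵐᵒᵖ S) :=
  have : Module.Finite Sᵐᵒᵖ (ModuleCat.of Sᵐᵒᵖ S) := .equiv (opLinearEquiv Sᵐᵒᵖ).symm
  isCountablyGenerated_of_finite _

theorem countableProjective_iff {N : ModuleCat.{v} Sᵐᵒᵖ} :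
    countableProjective Sᵐᵒᵖ N ↔
      ∃ Λ : Type v, Countable Λ ∧ Nonempty (Retract N (copower (ModuleCat.of Sᵐᵒᵖ S) Λ)) :=
  (and_congr_left' projective_iff_addClosure).trans <|
    countableAddClosure_iff (isCountablyGenerated_regular S)

end Projective

section Equivalence

theorem inducesEquivalence_of_map_eq_map_iff {T : Type u} [Ring T] {D : Type*} [Category* D]
    (F : ModuleCat.{v} T ⥤ D) (P : ObjectProperty (ModuleCat.{v} T)) (X : ModuleCat.{v} T)
    (Q : ObjectProperty D) (hobj : ∀ A, P A → Q (F.obj A))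
    (map_eq_map_iff : ∀ {A B : ModuleCat.{v} T}, P A → P B → ∀ f g : A ⟶ B,
      F.map f = F.map g ↔ f - g ∈ infiniteIdeal X A B)
    (full : ∀ {A B : ModuleCat.{v} T}, P A → P B → ∀ φ : F.obj A ⟶ F.obj B,
      ∃ f : A ⟶ B, F.map f = φ)
    (essSurj : ∀ N, Q N → ∃ A, P A ∧ Nonempty (F.obj A ≅ N)) :
    InducesEquivalence F P X Q := by
  refine ⟨fun A => hobj A.obj A.property, fun A B f g h => ObjectProperty.hom_ext _
    ((map_eq_map_iff A.property B.property f.hom g.hom).2 h), ?_⟩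
  refine { faithful := ⟨?_⟩, full := ⟨?_⟩, essSurj := ⟨?_⟩ }
  · rintro ⟨A⟩ ⟨B⟩ ⟨f⟩ ⟨g⟩ h
    exact CategoryTheory.Quotient.sound _
      ((map_eq_map_iff A.property B.property f.hom g.hom).1 (congrArg (fun k => k.hom) h))
  · rintro ⟨A⟩ ⟨B⟩ φ
    obtain ⟨f, hf⟩ := full A.property B.property φ.hom
    exact ⟨(CategoryTheory.Quotient.functor _).map (ObjectProperty.homMk f),
      ObjectProperty.hom_ext _ hf⟩
  · intro N
    obtain ⟨A, hA, ⟨e⟩⟩ := essSurj N.obj N.property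
    exact ⟨⟨⟨A, hA⟩⟩, ⟨Q.isoMk e⟩⟩

variable {R : Type u} [Ring R] {M X : ModuleCat.{v} Rᵐᵒᵖ} (hM : IsSmallRelativeTo M M)

include hM

theorem inducesEquivalence_homTensor (hX : addClosure M X)
    {P : ObjectProperty (ModuleCat.{v} Rᵐᵒᵖ)} (hP : P ≤ addClosure M)
    {Q : ObjectProperty (ModuleCat.{v} (End M ⧸ homTrace M X)ᵐᵒᵖ)}
    (hobj : ∀ A, P A → Q ((homTensor M (homTrace M X)).obj A))
    (essSurj : ∀ N, Q N → ∃ A, P A ∧ Nonempty ((homTensor M (homTrace M X)).obj A ≅ N)) :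
    InducesEquivalence (homTensor M (homTrace M X)) P X Q := by
  refine inducesEquivalence_of_map_eq_map_iff _ P X Q hobj (fun hA _ f g => ?_)
    (fun hA _ => homTensor_map_surjective _ hM (hP _ hA)) essSurj
  rw [← homTensor_map_eq_zero_iff hM hX (hP _ hA), Functor.map_sub, sub_eq_zero]

theorem inducesEquivalence_addClosure (hX : addClosure M X) :
    InducesEquivalence (homTensor M (homTrace M X)) (addClosure M) X
      (addClosure (ModuleCat.of (End M ⧸ homTrace M X)ᵐᵒᵖ (End M ⧸ homTrace M X))) := by
  refine inducesEquivalence_homTensor hM hX le_rfl (fun A hA => ?_) fun N hN => ?_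
  · obtain ⟨Λ, ⟨ρ⟩⟩ := addClosure_iff.1 hA
    exact addClosure_iff.2 ⟨Λ, ⟨homTensorRetract _ hM ρ⟩⟩
  · obtain ⟨Λ', ⟨ρ⟩⟩ := addClosure_iff.1 hX
    obtain ⟨Λ, ⟨σ⟩⟩ := addClosure_iff.1 hN
    obtain ⟨Λ'', A, -, hA, iso⟩ := exists_homTensor_obj_iso hM ρ σ
    exact ⟨A, addClosure_iff.2 ⟨Λ'', hA⟩, iso⟩

theorem inducesEquivalence_countableAddClosure (hMc : IsCountablyGenerated M)
    (hX : countableAddClosure M X) :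
    InducesEquivalence (homTensor M (homTrace M X)) (countableAddClosure M) X
      (countableProjective (End M ⧸ homTrace M X)ᵐᵒᵖ) := by
  refine inducesEquivalence_homTensor hM hX.1 (fun _ => And.left) (fun A hA => ?_) fun N hN => ?_
  · obtain ⟨Λ, hΛ, ⟨ρ⟩⟩ := (countableAddClosure_iff hMc).1 hA
    exact countableProjective_iff.2 ⟨Λ, hΛ, ⟨homTensorRetract _ hM ρ⟩⟩
  · obtain ⟨Λ', hΛ', ⟨ρ⟩⟩ := (countableAddClosure_iff hMc).1 hX
    obtain ⟨Λ, hΛ, ⟨σ⟩⟩ := countableProjective_iff.1 hN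
    obtain ⟨Λ'', A, hΛ'', hA, iso⟩ := exists_homTensor_obj_iso hM ρ σ
    exact ⟨A, (countableAddClosure_iff hMc).2 ⟨Λ'', hΛ'' hΛ hΛ', hA⟩, iso⟩

end Equivalence

end TraceQuotient

theorem mainTheorem4_general {R : Type u} [Ring R] (M : ModuleCat.{v} Rᵐᵒᵖ)
    (hM : IsSmallRelativeTo M M) (X : ModuleCat.{v} Rᵐᵒᵖ) (hX : addClosure M X) :
    ((∀ s : M ⟶ M, s ∈ homTrace M X ↔ s ∈ finiteIdeal X M M) ∧
      finiteIdeal X M M = infiniteIdeal X M M ∧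
      ∀ B : ModuleCat.{v} Rᵐᵒᵖ,
        finiteIdeal X M B = infiniteIdeal X M B ∧
        infiniteIdeal X M B = homMulIdeal M B (homTrace M X)) ∧
    InducesEquivalence (homTensor M (homTrace M X)) (addClosure M) X
      (addClosure (ModuleCat.of (End M ⧸ homTrace M X)ᵐᵒᵖ (End M ⧸ homTrace M X))) ∧
    (IsCountablyGenerated M → IsCountablyGenerated X →
      InducesEquivalence (homTensor M (homTrace M X)) (countableAddClosure M) X
        (countableProjective (End M ⧸ homTrace M X)ᵐᵒᵖ)) :=
  have small : IsSmallRelativeTo M X := hM.of_addClosure hX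
  ⟨⟨mem_homTrace_iff hM hX, small.finiteIdeal_eq_infiniteIdeal, fun _ =>
      ⟨small.finiteIdeal_eq_infiniteIdeal, infiniteIdeal_eq_homMulIdeal hM hX⟩⟩,
    inducesEquivalence_addClosure hM hX,
    fun hMc hXc => inducesEquivalence_countableAddClosure hM hMc ⟨hX, hXc⟩⟩

theorem mainTheorem4 {R : Type u} [Ring R] (M : ModuleCat.{v} Rᵐᵒᵖ) [Module.Finite Rᵐᵒᵖ M]
    (X : ModuleCat.{v} Rᵐᵒᵖ) (hX : addClosure M X) :
    ((∀ s : M ⟶ M, s ∈ homTrace M X ↔ s ∈ finiteIdeal X M M) ∧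
      finiteIdeal X M M = infiniteIdeal X M M ∧
      ∀ B : ModuleCat.{v} Rᵐᵒᵖ, addClosure M B →
        finiteIdeal X M B = infiniteIdeal X M B ∧
        infiniteIdeal X M B = homMulIdeal M B (homTrace M X)) ∧
    InducesEquivalence (homTensor M (homTrace M X)) (addClosure M) X
      (addClosure (ModuleCat.of (End M ⧸ homTrace M X)ᵐᵒᵖ (End M ⧸ homTrace M X))) ∧
    (IsCountablyGenerated X →
      InducesEquivalence (homTensor M (homTrace M X)) (countableAddClosure M) X
        (countableProjective (End M ⧸ homTrace M X)ᵐᵒᵖ)) := by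
  have h := mainTheorem4_general M (isSmallRelativeTo_of_finite M M) X hX
  exact ⟨⟨h.1.1, h.1.2.1, fun B _ => h.1.2.2 B⟩, h.2.1, h.2.2 (isCountablyGenerated_of_finite M)⟩
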